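/- **Proposition 2.1.** Let $k$ be a field. Let $\Delta$ be either the infinite linear quiver $\Delta_\infty$, with vertex set $I=\mathbb Z$, or the cyclic quiver $\Delta_n$ ($n\ge 2$), with vertex set $I=\mathbb Z/n\mathbb Z$; in both cases there is exactly one arrow $i\to i+1$ for each $i\in I$. Let $\mathrm{Rep}^0\Delta$ be the category of finite dimensional nilpotent representations of $\Delta$ over $k$, and let $\mathbf{dim}\,V=(\dim_k V_i)_{i\in I}$ be the dimension vector of $V$. For $i\in I$ and $l\ge 1$ let $S_i[l]$ be the uniserial representation with simple top $S_i$ and length $l$. For a multisegment $\mathfrak m=\sum_{i\in I,\,l\ge1} m_{i,l}[i,l]$ (with $m_{i,l}\in\mathbb N$, all but finitely many zero) put $M(\mathfrak m)=\bigoplus_{i,l} m_{i,l}S_i[l]$. For $M,N\in\mathrm{Rep}^0\Delta$ write $M\le_{\deg}N$ if $\mathbf{dim}\,M=\mathbf{dim}\,N$ and $\dim_k\mathrm{Hom}(M,X)\ge\dim_k\mathrm{Hom}(N,X)$ for all $X\in\mathrm{Rep}^0\Delta$. Let $\Pi$ be the set of all partitions $\lambda=(\lambda_1\ge\dots\ge\lambda_t\ge1)$,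 $t\ge 0$ (of arbitrary natural numbers). For $\lambda\in\Pi$ let $\mathfrak m_\lambda=\sum_{s=1}^t[1-s,\lambda_s]$, where $1-s$ is read modulo $n$ if $\Delta=\Delta_n$; so $M(\mathfrak m_\lambda)=S_0[\lambda_1]\oplus S_{-1}[\lambda_2]\oplus\dots\oplus S_{1-t}[\lambda_t]$. For $\Delta=\Delta_\infty$ this multisegment is written $\mathfrak m_\lambda^\infty$. Let $\lambda,\mu\in\Pi$. (1) If $\Delta=\Delta_\infty$, then $$\mathbf{dim}\,M(\mathfrak m_\mu^\infty)=\mathbf{dim}\,M(\mathfrak m_\lambda^\infty)\iff \mu=\lambda .$$ In particular, for each multisegment $\mathfrak m$ over $I=\mathbb Z$ there is at most one $\nu\in\Pi$ with $\mathfrak m=\mathfrak m_\nu^\infty$. (2) If $\Delta=\Delta_n$ with $n\ge2$, then $$M(\mathfrak m_\mu)\le_{\deg}M(\mathfrak m_\lambda)\implies \mu\preceq\lambda,$$ where $\preceq$ is the dominance order: $\mu\preceq\lambda\iff\sum_{j=1}^i\mu_j\le\sum_{j=1}^i\lambda_j$ for all $i\ge1$ (with $\lambda_j=0$ for $j$ larger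 than the number of parts of $\lambda$, and likewise for $\mu$). -/

import Mathlib

open scoped DirectSum

universe u

/-- A representation over `k` of the quiver with vertex set `I` and exactly one arrow `i ⟶ i + 1`
for every `i : I`. For `I = ℤ` this quiver is the infinite linear quiver `Δ_∞`, and for
`I = ZMod n` it is the cyclic quiver `Δ_n`. -/
structure QRep (k : Type u) [Field k] (I : Type) [AddGroupWithOne I] where
  V : I → Type u
  [addCommGroup : ∀ i, AddCommGroup (V i)]
  [module : ∀ i, Module k (V i)]
  x : ∀ i, V i →ₗ[k] V (i + 1)

namespace QRep

attribute [instance] QRep.addCommGroup QRep.module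

/-- The path of length `N` starting at `i` sends `v` to zero. -/
def Kills {k : Type u} [Field k] {I : Type} [AddGroupWithOne I] (M : QRep k I) :
    ℕ → ∀ i, M.V i → Prop
  | 0, _, v => v = 0
  | N + 1, i, v => Kills M N (i + 1) (M.x i v)

/-- `M` is nilpotent: for some `N`, all paths of length `N` act as zero. -/
def IsNilp {k : Type u} [Field k] {I : Type} [AddGroupWithOne I] (M : QRep k I) : Prop :=
  ∃ N : ℕ, ∀ (i : I) (v : M.V i), M.Kills N i v

/-- The total space `⨁ i, V i` is finite dimensional. -/
def IsFinDim {k : Type u} [Field k] {I : Type} [AddGroupWithOne I] (M : QRep k I) : Prop :=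
  (∀ i, Module.Finite k (M.V i)) ∧ {i | Nontrivial (M.V i)}.Finite

/-- The category `Rep⁰` of finite dimensional nilpotent representations (its objects). -/
def IsRepZero {k : Type u} [Field k] {I : Type} [AddGroupWithOne I] (M : QRep k I) : Prop :=
  M.IsFinDim ∧ M.IsNilp

/-- The dimension vector. -/
noncomputable def dimVec {k : Type u} [Field k] {I : Type} [AddGroupWithOne I] (M : QRep k I) :
    I → ℕ :=
  fun i => Module.finrank k (M.V i)

/-- The `k`-vector space of homomorphisms of representations. -/
def Hom {k : Type u} [Field k] {I : Type} [AddGroupWithOne I] (M N : QRep k I) :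
    Submodule k (∀ i, M.V i →ₗ[k] N.V i) where
  carrier := {f | ∀ i, N.x i ∘ₗ f i = f (i + 1) ∘ₗ M.x i}
  add_mem' := by
    intro f g hf hg i
    simp only [Set.mem_ofPred_eq] at hf hg
    simp only [Pi.add_apply, LinearMap.comp_add, LinearMap.add_comp, hf i, hg i]
  zero_mem' := by
    intro i
    simp
  smul_mem' := by
    intro c f hf i
    simp only [Set.mem_ofPred_eq] at hf
    simp only [Pi.smul_apply, LinearMap.comp_smul, LinearMap.smul_comp, hf i]

/-- The degeneration order: `M ≤_deg N`. -/
def DegLE {k : Type u} [Field k] {I : Type} [AddGroupWithOne I] (M N : QRep k I) : Prop :=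
  M.dimVec = N.dimVec ∧
    ∀ X : QRep k I, X.IsRepZero →
      Module.finrank k (Hom N X) ≤ Module.finrank k (Hom M X)

/-- The direct sum of a family of representations. -/
noncomputable def directSum {k : Type u} [Field k] {I : Type} [AddGroupWithOne I] {J : Type}
    (R : J → QRep k I) : QRep k I where
  V i := ⨁ j, (R j).V i
  x i := DirectSum.lmap fun j => (R j).x i

/-- The representation `S_i[l]` with simple top `S_i` and length `l`. It is uniserial, with a basis
`e_0, …, e_{l-1}` such that `e_t` sits at the vertex `i + t` and the arrows map `e_t` to `e_{t+1}`
(and `e_{l-1}` to `0`). The space at `j` consists of the coordinate functions on the set of those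
`t` with `i + t = j`. -/
def S (k : Type u) [Field k] {I : Type} [AddGroupWithOne I] (i : I) (l : ℕ) : QRep k I where
  V j := {t : Fin l // i + ((t : ℕ) : I) = j} → k
  x j :=
    { toFun := fun f t =>
        if h : 0 < (t.1 : ℕ) then
          f ⟨⟨(t.1 : ℕ) - 1, by omega⟩, by
            have ht := t.2
            rw [← Nat.succ_pred_eq_of_pos h, Nat.cast_succ, ← add_assoc] at ht
            exact add_right_cancel ht⟩
        else 0
      map_add' := by
        intro f g
        funext t
        by_cases h : 0 < (t.1 : ℕ) <;> simp [h]
      map_smul' := by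
        intro c f
        funext t
        by_cases h : 0 < (t.1 : ℕ) <;> simp [h] }

end QRep

/-- Multisegments `∑ m_{i,l} [i, l]` with `i : I`, `l ≥ 1`, and finitely many nonzero `m_{i,l}`. -/
abbrev Multisegment (I : Type) : Type := (I × ℕ+) →₀ ℕ

/-- The representation `M(m) = ⨁ m_{i,l} S_i[l]` of a multisegment. -/
noncomputable def Multisegment.rep (k : Type u) [Field k] {I : Type} [AddGroupWithOne I]
    (m : Multisegment I) : QRep k I :=
  QRep.directSum fun p : (Σ q : I × ℕ+, Fin (m q)) => QRep.S k p.1.1 (p.1.2 : ℕ)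

/-- Partitions `λ = (λ_1 ≥ ⋯ ≥ λ_t ≥ 1)`, `t ≥ 0`, of arbitrary natural numbers. -/
structure Ptn where
  parts : List ℕ
  sorted : parts.SortedGE
  pos : ∀ a ∈ parts, 0 < a

namespace Ptn

/-- The multisegment `m_λ = ∑_{s=1}^t [1 - s, λ_s]`; the index `s : Fin t` below is the usual one
minus one. -/
noncomputable def mseg (I : Type) [AddGroupWithOne I] (lam : Ptn) : Multisegment I :=
  ∑ s : Fin lam.parts.length,
    Finsupp.single
      ((1 : I) - (((s : ℕ) + 1 : ℕ) : I),
        (⟨lam.parts.get s, lam.pos _ (List.get_mem _ s)⟩ : ℕ+)) 1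

/-- The sum of the first `i` parts, with the convention `λ_j = 0` for `j > t`. -/
def partialSum (lam : Ptn) (i : ℕ) : ℕ := ∑ j ∈ Finset.range i, lam.parts.getD j 0

/-- The dominance order `μ ⪯ λ`. -/
def DomLE (mu lam : Ptn) : Prop := ∀ i : ℕ, 1 ≤ i → mu.partialSum i ≤ lam.partialSum i

end Ptn

/-!
A homomorphism from `S_i[l]` to `S_v[m]` (with `l ≥ 1`) is determined by the image of the
generator `e_0`, which may be any combination of the basis vectors `e_d` of `S_v[m]` at the vertex
`i` with `m ≤ d + l`, that is, those killed by paths of length `l` (`QRep.finrank_hom_S`). For given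
`i`, each `d < m` with `m ≤ d + l` has this property for exactly one vertex `v`, so
`∑ v, dim Hom (S_i[l], S_v[m]) = min l m`. Hence
`∑ v, dim Hom (M(m_λ), S_v[m]) = ∑ s, min λ_s m` is the number of boxes in the first `m` columns of
`λ` (`Ptn.sum_finrank_hom_rep`).

For the cyclic quiver, `M(m_μ) ≤_deg M(m_λ)` therefore says at least that `μ` and `λ` have the same
size and that the first `m` columns of `μ` contain at least as many boxes as those of `λ`, for all
`m`. Taking `m = λ_i`, this gives the dominance inequality for the first `i` rows
(`Ptn.domLE_of_sum_min_le`).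

For the linear quiver, the dimension of `M(m_λ)` at `d` is the number of boxes of content `d`. The
boxes on a diagonal form an initial segment of it, so these numbers determine `λ`
(`Ptn.lt_part_iff`).
-/

/-! ### Diagonals and dominance of partitions -/

namespace Ptn

/-- The parts of a partition as a function on `ℕ`, extended by zero. -/
def part (lam : Ptn) (s : ℕ) : ℕ := lam.parts.getD s 0

lemma part_eq_get (lam : Ptn) (s : Fin lam.parts.length) : lam.part s = lam.parts.get s := by
  simp [part]

lemma part_of_length_le (lam : Ptn) {s : ℕ} (h : lam.parts.length ≤ s) : lam.part s = 0 := by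
  simp [part, h]

lemma part_pos_iff (lam : Ptn) {s : ℕ} : 0 < lam.part s ↔ s < lam.parts.length := by
  refine ⟨fun h => ?_, fun h => ?_⟩
  · by_contra! hs
    rw [lam.part_of_length_le hs] at h
    exact h.false
  · rw [lam.part_eq_get ⟨s, h⟩]
    exact lam.pos _ (List.get_mem _ _)

lemma part_antitone (lam : Ptn) : Antitone lam.part := by
  intro s t hst
  by_cases ht : t < lam.parts.length
  · rw [lam.part_eq_get ⟨t, ht⟩, lam.part_eq_get ⟨s, hst.trans_lt ht⟩]
    exact lam.sorted.antitone_get (Fin.mk_le_mk.2 hst)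
  · rw [lam.part_of_length_le (not_lt.1 ht)]
    exact Nat.zero_le _

lemma ext_part {lam mu : Ptn} (h : ∀ s, lam.part s = mu.part s) : lam = mu := by
  have hlen : lam.parts.length = mu.parts.length :=
    eq_of_forall_lt_iff fun s => by rw [← part_pos_iff, ← part_pos_iff, h]
  have hparts : lam.parts = mu.parts := by
    refine List.ext_get hlen fun s h₁ h₂ => ?_
    rw [← lam.part_eq_get ⟨s, h₁⟩, ← mu.part_eq_get ⟨s, h₂⟩]
    exact h s
  cases lam
  cases mu
  cases hparts
  rfl

lemma sum_get_eq_sum_range (lam : Ptn) {N : ℕ} (hN : lam.parts.length ≤ N) (φ : ℕ → ℕ)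
    (h0 : φ 0 = 0) :
    ∑ s : Fin lam.parts.length, φ (lam.parts.get s) = ∑ s ∈ Finset.range N, φ (lam.part s) := by
  rw [← Finset.sum_subset (Finset.range_subset_range.2 hN), Finset.sum_range]
  · exact Finset.sum_congr rfl fun s _ => by rw [part_eq_get]
  · intro s _ hs
    rw [lam.part_of_length_le (by simpa using hs), h0]

/-- The boxes of the Young diagram of `lam` on the diagonal of content `d`, counted by their row
`s`; the column is then `s + d`. Rows and columns are numbered from zero. -/
def diagCount (lam : Ptn) (d : ℤ) : ℕ :=
  ((Finset.range lam.parts.length).filter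
    fun s : ℕ => 0 ≤ (s : ℤ) + d ∧ (s : ℤ) + d < lam.part s).card

/-- The boxes on a diagonal form an initial segment of it, so the number of boxes on it decides
which of its cells belong to the diagram. -/
lemma lt_part_iff (lam : Ptn) (s t : ℕ) :
    t < lam.part s ↔ min s t < lam.diagCount ((t : ℤ) - s) := by
  unfold diagCount
  constructor
  · intro h
    have hsub : Finset.Ico (s - t) (s + 1) ⊆ (Finset.range lam.parts.length).filter
        fun r : ℕ => 0 ≤ (r : ℤ) + ((t : ℤ) - s) ∧ (r : ℤ) + ((t : ℤ) - s) < lam.part r := by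
      intro r hr
      rw [Finset.mem_Ico] at hr
      have hle := lam.part_antitone (show r ≤ s by omega)
      have hpos := (lam.part_pos_iff (s := r)).1 (by omega)
      simp only [Finset.mem_filter, Finset.mem_range]
      omega
    have := Finset.card_le_card hsub
    rw [Nat.card_Ico] at this
    omega
  · intro h
    by_contra! hst
    have hsub : (Finset.range lam.parts.length).filter
        (fun r : ℕ => 0 ≤ (r : ℤ) + ((t : ℤ) - s) ∧ (r : ℤ) + ((t : ℤ) - s) < lam.part r) ⊆
          Finset.Ico (s - t) s := by
      intro r hr
      simp only [Finset.mem_filter, Finset.mem_range] at hr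
      rw [Finset.mem_Ico]
      refine ⟨by omega, ?_⟩
      by_contra! hsr
      have := lam.part_antitone hsr
      omega
    have := Finset.card_le_card hsub
    rw [Nat.card_Ico] at this
    omega

lemma eq_of_diagCount_eq {lam mu : Ptn} (h : ∀ d, lam.diagCount d = mu.diagCount d) :
    lam = mu :=
  ext_part fun s => eq_of_forall_lt_iff fun t => by rw [lt_part_iff, lt_part_iff, h]

/-- If `mu` and `lam` have equal size, and for every `m` the first `m` columns of `mu` contain at
least as many boxes as those of `lam`, then `mu` is dominated by `lam`. -/
lemma domLE_of_sum_min_le {lam mu : Ptn} (hsize : mu.parts.sum = lam.parts.sum)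
    (hmin : ∀ m : ℕ, ∑ s : Fin lam.parts.length, min (lam.parts.get s) m ≤
      ∑ s : Fin mu.parts.length, min (mu.parts.get s) m) :
    mu.DomLE lam := by
  intro i hi
  -- For `m` the `i`-th part, the first `i` rows of `lam` fill the first `m` columns, and all later
  -- rows lie within them.
  obtain ⟨m, hm⟩ : ∃ m, m = lam.part (i - 1) := ⟨_, rfl⟩
  set N := i + lam.parts.length + mu.parts.length with hN
  have hmin := hmin m
  rw [lam.sum_get_eq_sum_range (N := N) (by omega) (fun a => min a m) (by simp),
    mu.sum_get_eq_sum_range (N := N) (by omega) (fun a => min a m) (by simp)] at hmin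
  have hsum (nu : Ptn) (h : nu.parts.length ≤ N) :
      nu.parts.sum = ∑ s ∈ Finset.range N, nu.part s := by
    rw [← nu.sum_get_eq_sum_range h (fun a => a) rfl]
    simp [← List.sum_ofFn]
  rw [hsum mu (by omega), hsum lam (by omega)] at hsize
  have hiN : i ≤ N := by omega
  have hsplit (φ : ℕ → ℕ) := (Finset.sum_range_add_sum_Ico φ hiN).symm
  rw [hsplit, hsplit] at hmin hsize
  have h₁ : ∑ s ∈ Finset.range i, min (lam.part s) m = ∑ s ∈ Finset.range i, m :=
    Finset.sum_congr rfl fun s hs => min_eq_right <| by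
      rw [Finset.mem_range] at hs
      rw [hm]
      exact lam.part_antitone (by omega)
  have h₂ : ∑ s ∈ Finset.Ico i N, min (lam.part s) m = ∑ s ∈ Finset.Ico i N, lam.part s :=
    Finset.sum_congr rfl fun s hs => min_eq_left <| by
      rw [Finset.mem_Ico] at hs
      rw [hm]
      exact lam.part_antitone (by omega)
  have h₃ : ∑ s ∈ Finset.range i, min (mu.part s) m ≤ ∑ s ∈ Finset.range i, m :=
    Finset.sum_le_sum fun s _ => min_le_right _ _
  have h₄ : ∑ s ∈ Finset.Ico i N, min (mu.part s) m ≤ ∑ s ∈ Finset.Ico i N, mu.part s :=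
    Finset.sum_le_sum fun s _ => min_le_left _ _
  change ∑ s ∈ Finset.range i, mu.part s ≤ ∑ s ∈ Finset.range i, lam.part s
  omega

end Ptn

/-! ### Sums over the segments of a multisegment -/

namespace Multisegment

variable {I : Type}

lemma finite_sigma_fin (m : Multisegment I) : Finite (Σ q : I × ℕ+, Fin (m q)) := by
  refine Finite.of_injective
    (β := Σ q : m.support, Fin (m q)) (fun p => ⟨⟨p.1, ?_⟩, p.2⟩) ?_
  · rw [Finsupp.mem_support_iff]
    exact (Fin.pos p.2).ne'
  · rintro ⟨q, a⟩ ⟨q', a'⟩ h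
    simp only [Sigma.mk.injEq, Subtype.mk.injEq] at h
    obtain ⟨rfl, h⟩ := h
    simpa using h

lemma sum_sigma_fin (m : Multisegment I) [Fintype (Σ q : I × ℕ+, Fin (m q))]
    (φ : I × ℕ+ → ℕ) :
    ∑ p : (Σ q : I × ℕ+, Fin (m q)), φ p.1 = m.sum fun q c => c * φ q := by
  classical
  rw [Finsupp.sum, ← Finset.sum_fiberwise_of_maps_to (s := Finset.univ) (t := m.support)
    (g := fun p : (Σ q : I × ℕ+, Fin (m q)) => p.1)
    (fun p _ => Finsupp.mem_support_iff.2 (Fin.pos p.2).ne')]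
  refine Finset.sum_congr rfl fun q _ => ?_
  have hcard : (Finset.univ.filter fun p : (Σ q : I × ℕ+, Fin (m q)) => p.1 = q) =
      Finset.univ.map (Function.Embedding.sigmaMk q) := by
    ext ⟨q', a⟩
    simp only [Finset.mem_filter, Finset.mem_univ, true_and, Finset.mem_map,
      Function.Embedding.sigmaMk_apply]
    constructor
    · rintro rfl
      exact ⟨a, rfl⟩
    · rintro ⟨b, hb⟩
      exact (congrArg Sigma.fst hb).symm
  rw [hcard, Finset.sum_map]
  simp

lemma sum_mseg [AddGroupWithOne I] (lam : Ptn) [Fintype (Σ q : I × ℕ+, Fin (lam.mseg I q))]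
    (φ : I → ℕ → ℕ) :
    ∑ p : (Σ q : I × ℕ+, Fin (lam.mseg I q)), φ p.1.1 p.1.2 =
      ∑ s : Fin lam.parts.length, φ (1 - (((s : ℕ) + 1 : ℕ) : I)) (lam.parts.get s) := by
  rw [sum_sigma_fin (lam.mseg I) (fun q => φ q.1 q.2), Ptn.mseg,
    ← Finsupp.sum_finsetSum_index (by simp) (by intros; ring)]
  refine Finset.sum_congr rfl fun s _ => ?_
  rw [Finsupp.sum_single_index (by simp), one_mul]
  rfl

end Multisegment

/-! ### Homomorphisms between uniserial representations -/

namespace QRep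

variable {k : Type u} [Field k] {I : Type} [AddGroupWithOne I]

lemma finrank_S (i : I) (l : ℕ) (j : I) :
    Module.finrank k ((S k i l).V j) = Nat.card {t : Fin l // i + ((t : ℕ) : I) = j} := by
  classical
  change Module.finrank k ({t : Fin l // i + ((t : ℕ) : I) = j} → k) = _
  rw [Module.finrank_fintype_fun_eq_card, Nat.card_eq_fintype_card]

/-- The basis vector of `S_i[l]` indexed by `t`. -/
noncomputable def S.basisVec (i : I) (l : ℕ) {j : I} (t : {t : Fin l // i + ((t : ℕ) : I) = j}) :
    (S k i l).V j :=
  open Classical in (Pi.single t 1 : {t : Fin l // i + ((t : ℕ) : I) = j} → k)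

lemma S.basisVec_apply [DecidableEq I] (i : I) (l : ℕ) {j : I}
    (t t' : {t : Fin l // i + ((t : ℕ) : I) = j}) :
    (S.basisVec i l t : (S k i l).V j) t' = if t' = t then 1 else 0 := by
  classical
  unfold S.basisVec
  rw [Pi.single_apply]

lemma S.x_apply (i : I) (l : ℕ) (j : I) (g : (S k i l).V j)
    (t : {t : Fin l // i + ((t : ℕ) : I) = j + 1}) :
    (S k i l).x j g t = if h : 0 < (t.1 : ℕ) then
      g ⟨⟨(t.1 : ℕ) - 1, by omega⟩, by
        have ht := t.2
        rw [← Nat.succ_pred_eq_of_pos h, Nat.cast_succ, ← add_assoc] at ht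
        exact add_right_cancel ht⟩ else 0 :=
  rfl

lemma S.apply_congr {i : I} {l : ℕ} {j : I} (g : (S k i l).V j)
    {t t' : {t : Fin l // i + ((t : ℕ) : I) = j}} (h : (t.1 : ℕ) = t'.1) : g t = g t' :=
  congrArg (g : {t : Fin l // i + ((t : ℕ) : I) = j} → k) (Subtype.ext (Fin.ext h))

lemma S.x_basisVec (i : I) (l : ℕ) {j : I} (t : {t : Fin l // i + ((t : ℕ) : I) = j}) :
    (S k i l).x j (S.basisVec i l t) = if h : (t.1 : ℕ) + 1 < l then
      S.basisVec i l ⟨⟨t.1 + 1, h⟩, by rw [Nat.cast_succ, ← add_assoc, t.2]⟩ else 0 := by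
  classical
  funext t'
  rw [S.x_apply]
  obtain ⟨⟨t, ht⟩, hj⟩ := t
  obtain ⟨⟨t', ht'⟩, hj'⟩ := t'
  simp only [S.basisVec_apply]
  split_ifs with h₁ h₂ h₂
  all_goals try simp only [S.basisVec_apply, Subtype.mk.injEq, Fin.mk.injEq] at *
  · rw [if_pos (by omega)]
  · omega
  · rw [if_neg (by omega)]
  · rfl
  · rw [if_neg (by omega)]
  · rfl

lemma S.linearMap_ext {i : I} {l : ℕ} {j : I} {W : Type u} [AddCommGroup W] [Module k W]
    {f g : (S k i l).V j →ₗ[k] W}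
    (h : ∀ t, f (S.basisVec i l t) = g (S.basisVec i l t)) : f = g := by
  classical
  refine LinearMap.pi_ext' (R := k) (φ := fun _ : {t : Fin l // i + ((t : ℕ) : I) = j} => k)
    fun t => LinearMap.ext_ring ?_
  exact h t

lemma vertex_sub {i v j : I} {r t : ℕ} (hr : v + (r : I) = j) (ht : i + (t : I) = j) (h : t ≤ r) :
    v + ((r - t : ℕ) : I) = i := by
  rw [← ht, ← Nat.sub_add_cancel h, Nat.cast_add, ← add_assoc] at hr
  simpa using add_right_cancel hr

/-- A homomorphism out of `S_i[l]` is determined by the image of the generator `e_0`: the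
coefficient of `e_r` in the image of `e_t` is that of `e_{r-t}` in the image of `e_0`. -/
lemma Hom.apply_basisVec {i v : I} {l m : ℕ} (f : Hom (S k i l) (S k v m)) (hl : 0 < l) :
    ∀ (t : ℕ) (ht : t < l) (j : I) (hj : i + (t : I) = j)
      (r : {r : Fin m // v + ((r : ℕ) : I) = j}),
      f.1 j (S.basisVec i l ⟨⟨t, ht⟩, hj⟩) r = if h : t ≤ (r.1 : ℕ) then
        f.1 i (S.basisVec i l ⟨⟨0, hl⟩, by simp⟩)
          ⟨⟨r.1 - t, by omega⟩, vertex_sub r.2 hj h⟩ else 0 := by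
  intro t
  induction t with
  | zero =>
    intro _ j hj r
    obtain rfl : i = j := by simpa using hj
    simp
  | succ t ih =>
    intro ht j hj r
    obtain rfl : (i + (t : I)) + 1 = j := by rw [← hj, Nat.cast_succ, add_assoc]
    have hx := S.x_basisVec (k := k) i l (j := i + (t : I)) ⟨⟨t, by omega⟩, rfl⟩
    rw [dif_pos ht] at hx
    have hf := LinearMap.congr_fun (f.2 (i + (t : I)))
      (S.basisVec i l ⟨⟨t, by omega⟩, rfl⟩)
    simp only [LinearMap.comp_apply] at hf
    rw [hx] at hf
    rw [← hf, S.x_apply]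
    split_ifs with h₁ h₂ h₂
    · rw [ih (by omega) _ rfl, dif_pos (by simp only; omega)]
      exact S.apply_congr _ (by simp only; omega)
    · rw [ih (by omega) _ rfl, dif_neg (by simp only; omega)]
    · omega
    · rfl

/-- The map sending a homomorphism `S_i[l] → S_v[m]` to those coordinates of the image of the
generator which are not forced to vanish by the relation `x ^ l = 0` on the generator. -/
noncomputable def Hom.genCoord (k : Type u) [Field k] (i v : I) {l : ℕ} (m : ℕ) (hl : 0 < l) :
    Hom (S k i l) (S k v m) →ₗ[k]
      ({d : Fin m // v + ((d : ℕ) : I) = i ∧ m ≤ (d : ℕ) + l} → k) where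
  toFun f d := f.1 i (S.basisVec i l ⟨⟨0, hl⟩, by simp⟩) ⟨d.1, d.2.1⟩
  map_add' _ _ := rfl
  map_smul' _ _ := rfl

lemma Hom.genCoord_injective (i v : I) {l : ℕ} (m : ℕ) (hl : 0 < l) :
    Function.Injective (Hom.genCoord k i v m hl) := by
  rw [injective_iff_map_eq_zero]
  intro f hf
  have hzero : ∀ d, f.1 i (S.basisVec i l ⟨⟨0, hl⟩, by simp⟩) d = 0 := by
    intro d
    by_cases hd : m ≤ (d.1 : ℕ) + l
    · exact congrFun hf ⟨d.1, d.2, hd⟩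
    -- Otherwise the coefficient survives in the image of `x e_{l-1} = 0`.
    · have hx := S.x_basisVec (k := k) i l (j := i + ((l - 1 : ℕ) : I))
        ⟨⟨l - 1, by omega⟩, rfl⟩
      rw [dif_neg (by simp only; omega)] at hx
      have hfx := LinearMap.congr_fun (f.2 (i + ((l - 1 : ℕ) : I)))
        (S.basisVec i l ⟨⟨l - 1, by omega⟩, rfl⟩)
      simp only [LinearMap.comp_apply] at hfx
      rw [hx, map_zero] at hfx
      have hv : v + (((d.1 : ℕ) + l : ℕ) : I) = i + ((l - 1 : ℕ) : I) + 1 := by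
        rw [Nat.cast_add, ← add_assoc, d.2, add_assoc, ← Nat.cast_succ]
        congr 2
        omega
      have h := congrFun hfx ⟨⟨d.1 + l, by omega⟩, hv⟩
      rw [S.x_apply, dif_pos (by simp only; omega),
        Hom.apply_basisVec f hl _ _ _ rfl, dif_pos (by simp only; omega)] at h
      refine Eq.trans ?_ h
      exact S.apply_congr _ (by simp only; omega)
  refine Subtype.ext (funext fun j => S.linearMap_ext fun t => funext fun r => ?_)
  rw [Hom.apply_basisVec f hl t.1 t.1.2 j t.2 r]
  split_ifs
  · exact hzero _
  · rfl

/-- The matrix of the homomorphism `S_i[l] → S_v[m]` with prescribed coordinates of the image of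
the generator. -/
def Hom.ofGenMatrix {i v : I} {l m : ℕ}
    (c : {d : Fin m // v + ((d : ℕ) : I) = i ∧ m ≤ (d : ℕ) + l} → k) (j : I) :
    Matrix {r : Fin m // v + ((r : ℕ) : I) = j} {t : Fin l // i + ((t : ℕ) : I) = j} k :=
  fun r t => if h : (t.1 : ℕ) ≤ r.1 ∧ m ≤ (r.1 : ℕ) - t.1 + l then
    c ⟨⟨r.1 - t.1, by omega⟩, vertex_sub r.2 t.2 h.1, h.2⟩ else 0

/-- The matrices `Hom.ofGenMatrix` as linear maps between the vertex spaces. -/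
noncomputable def Hom.ofGen {i v : I} {l m : ℕ}
    (c : {d : Fin m // v + ((d : ℕ) : I) = i ∧ m ≤ (d : ℕ) + l} → k) (j : I) :
    (S k i l).V j →ₗ[k] (S k v m).V j :=
  open Classical in (Hom.ofGenMatrix c j).mulVecLin

lemma Hom.ofGen_basisVec {i v : I} {l m : ℕ}
    (c : {d : Fin m // v + ((d : ℕ) : I) = i ∧ m ≤ (d : ℕ) + l} → k) (j : I)
    (t : {t : Fin l // i + ((t : ℕ) : I) = j}) (r : {r : Fin m // v + ((r : ℕ) : I) = j}) :
    Hom.ofGen c j (S.basisVec i l t) r = Hom.ofGenMatrix c j r t := by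
  classical
  unfold Hom.ofGen S.basisVec
  exact congrFun (Matrix.mulVec_single_one (Hom.ofGenMatrix c j) t) r

lemma Hom.genCoord_surjective (i v : I) {l : ℕ} (m : ℕ) (hl : 0 < l) :
    Function.Surjective (Hom.genCoord k i v m hl) := by
  intro c
  refine ⟨⟨Hom.ofGen c, fun j => S.linearMap_ext fun t => funext fun r => ?_⟩, funext fun d => ?_⟩
  · rw [LinearMap.comp_apply, LinearMap.comp_apply, S.x_apply, S.x_basisVec]
    obtain ⟨⟨t, ht⟩, hj⟩ := t
    obtain ⟨⟨r, hr⟩, hj'⟩ := r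
    by_cases h₁ : 0 < r
    · rw [dif_pos h₁, Hom.ofGen_basisVec]
      by_cases h₂ : t + 1 < l
      · rw [dif_pos h₂, Hom.ofGen_basisVec]
        unfold Hom.ofGenMatrix
        simp only
        have hsub : r - 1 - t = r - (t + 1) := by omega
        by_cases h₃ : t + 1 ≤ r ∧ m ≤ r - (t + 1) + l
        · rw [dif_pos h₃, dif_pos (by omega)]
          congr 3
        · rw [dif_neg h₃, dif_neg (by omega)]
      · rw [dif_neg h₂, map_zero]
        exact dif_neg (by simp only; omega)
    · rw [dif_neg h₁]
      split_ifs with h₂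
      · rw [Hom.ofGen_basisVec]
        unfold Hom.ofGenMatrix
        rw [dif_neg fun h => h₁ ((Nat.succ_pos t).trans_le h.1)]
      · rw [map_zero]
        rfl
  · refine (Hom.ofGen_basisVec c i _ _).trans ?_
    unfold Hom.ofGenMatrix
    exact dif_pos ⟨Nat.zero_le _, d.2.2⟩

/-- Homomorphisms between two uniserial representations, in coordinates. -/
noncomputable def Hom.genEquiv (k : Type u) [Field k] (i v : I) {l : ℕ} (m : ℕ) (hl : 0 < l) :
    Hom (S k i l) (S k v m) ≃ₗ[k]
      ({d : Fin m // v + ((d : ℕ) : I) = i ∧ m ≤ (d : ℕ) + l} → k) :=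
  LinearEquiv.ofBijective (Hom.genCoord k i v m hl)
    ⟨Hom.genCoord_injective i v m hl, Hom.genCoord_surjective i v m hl⟩

lemma finite_hom_S (i v : I) {l : ℕ} (m : ℕ) (hl : 0 < l) :
    Module.Finite k (Hom (S k i l) (S k v m)) :=
  Module.Finite.equiv (Hom.genEquiv k i v m hl).symm

lemma finrank_hom_S (i v : I) {l : ℕ} (m : ℕ) (hl : 0 < l) :
    Module.finrank k (Hom (S k i l) (S k v m)) =
      Nat.card {d : Fin m // v + ((d : ℕ) : I) = i ∧ m ≤ (d : ℕ) + l} := by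
  classical
  rw [(Hom.genEquiv k i v m hl).finrank_eq, Module.finrank_fintype_fun_eq_card,
    Nat.card_eq_fintype_card]

lemma S.kills_of_forall (v : I) (m : ℕ) : ∀ (N : ℕ) (j : I) (g : (S k v m).V j),
    (∀ t : {t : Fin m // v + ((t : ℕ) : I) = j}, g t ≠ 0 → m ≤ (t.1 : ℕ) + N) →
      (S k v m).Kills N j g := by
  intro N
  induction N with
  | zero =>
    intro j g h
    refine funext fun t => ?_
    by_contra ht
    have := h t ht
    omega
  | succ N ih =>
    intro j g h
    refine ih _ _ fun t ht => ?_
    rw [S.x_apply] at ht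
    split_ifs at ht with h₁
    · have := h _ ht
      simp only at this
      omega
    · exact absurd rfl ht

lemma isRepZero_S [Finite I] (v : I) (m : ℕ) : (S k v m).IsRepZero := by
  classical
  refine ⟨⟨fun j => ?_, Set.toFinite _⟩, m, fun j g => S.kills_of_forall v m m j g ?_⟩
  · change Module.Finite k ({t : Fin m // v + ((t : ℕ) : I) = j} → k)
    infer_instance
  · intro t _
    omega

/-! ### Direct sums -/

/-- The inclusion of a summand, at the vertex `i`. -/
noncomputable def directSum.incl {J : Type} (R : J → QRep k I) (p : J) (i : I) :
    (R p).V i →ₗ[k] (directSum R).V i :=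
  open Classical in DirectSum.lof k J (fun q => (R q).V i) p

/-- The linear map out of a direct sum with given restrictions to the summands, at the vertex
`i`. -/
noncomputable def directSum.desc {J : Type} (R : J → QRep k I) {i : I} {W : Type u}
    [AddCommGroup W] [Module k W] (g : ∀ p, (R p).V i →ₗ[k] W) : (directSum R).V i →ₗ[k] W :=
  open Classical in DirectSum.toModule k J W g

lemma directSum.desc_incl {J : Type} (R : J → QRep k I) {i : I} {W : Type u}
    [AddCommGroup W] [Module k W] (g : ∀ p, (R p).V i →ₗ[k] W) (p : J) (u : (R p).V i) :
    directSum.desc R g (directSum.incl R p i u) = g p u := by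
  classical exact DirectSum.toModule_lof _ _ _

lemma directSum.x_incl {J : Type} (R : J → QRep k I) (p : J) (i : I) (u : (R p).V i) :
    (directSum R).x i (directSum.incl R p i u) = directSum.incl R p (i + 1) ((R p).x i u) := by
  classical exact DirectSum.lmap_lof _ _ _

lemma directSum.linearMap_ext {J : Type} (R : J → QRep k I) {i : I} {W : Type u}
    [AddCommGroup W] [Module k W] {f g : (directSum R).V i →ₗ[k] W}
    (h : ∀ p u, f (directSum.incl R p i u) = g (directSum.incl R p i u)) : f = g := by
  classical exact DirectSum.linearMap_ext k fun p => LinearMap.ext fun u => h p u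

/-- Homomorphisms out of a direct sum are families of homomorphisms out of the summands. -/
noncomputable def homDirectSumEquiv {J : Type} (R : J → QRep k I) (X : QRep k I) :
    Hom (directSum R) X ≃ₗ[k] ∀ p, Hom (R p) X where
  toFun f p := ⟨fun i => f.1 i ∘ₗ directSum.incl R p i, fun i => LinearMap.ext fun u => by
    have h := LinearMap.congr_fun (f.2 i) (directSum.incl R p i u)
    simp only [LinearMap.comp_apply, directSum.x_incl] at h ⊢
    exact h⟩
  map_add' _ _ := rfl
  map_smul' _ _ := rfl
  invFun g := ⟨fun i => directSum.desc R fun p => (g p).1 i, fun i =>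
    directSum.linearMap_ext R fun p u => by
      simp only [LinearMap.comp_apply, directSum.x_incl, directSum.desc_incl]
      exact LinearMap.congr_fun ((g p).2 i) u⟩
  left_inv f := Subtype.ext <| funext fun i => directSum.linearMap_ext R fun p u =>
    directSum.desc_incl R _ p u
  right_inv g := funext fun p => Subtype.ext <| funext fun i => LinearMap.ext fun u =>
    directSum.desc_incl R (fun q => (g q).1 i) p u

lemma finrank_hom_directSum {J : Type} [Fintype J] (R : J → QRep k I) (X : QRep k I)
    (h : ∀ p, Module.Finite k (Hom (R p) X)) :
    Module.finrank k (Hom (directSum R) X) = ∑ p, Module.finrank k (Hom (R p) X) := by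
  rw [(homDirectSumEquiv R X).finrank_eq, Module.finrank_pi_fintype]

lemma dimVec_directSum {J : Type} [Fintype J] (R : J → QRep k I) (i : I)
    (h : ∀ p, Module.Finite k ((R p).V i)) :
    (directSum R).dimVec i = ∑ p, (R p).dimVec i :=
  Module.finrank_directSum k fun p => (R p).V i

end QRep

/-! ### The representation of a partition -/

namespace Ptn

variable {k : Type u} [Field k] {I : Type} [AddGroupWithOne I]

lemma dimVec_rep (lam : Ptn) (j : I) :
    ((lam.mseg I).rep k).dimVec j = ∑ s : Fin lam.parts.length,
      Nat.card {t : Fin (lam.parts.get s) // 1 - (((s : ℕ) + 1 : ℕ) : I) + ((t : ℕ) : I) = j} := by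
  classical
  have := (lam.mseg I).finite_sigma_fin
  have := Fintype.ofFinite (Σ q : I × ℕ+, Fin (lam.mseg I q))
  rw [Multisegment.rep, QRep.dimVec_directSum]
  · simp only [QRep.dimVec, QRep.finrank_S]
    exact Multisegment.sum_mseg lam fun i l => Nat.card {t : Fin l // i + ((t : ℕ) : I) = j}
  · intro p
    change Module.Finite k ({t : Fin (p.1.2 : ℕ) // p.1.1 + ((t : ℕ) : I) = j} → k)
    infer_instance

lemma finrank_hom_rep (lam : Ptn) (v : I) (m : ℕ) :
    Module.finrank k (QRep.Hom ((lam.mseg I).rep k) (QRep.S k v m)) =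
      ∑ s : Fin lam.parts.length, Nat.card {d : Fin m //
        v + ((d : ℕ) : I) = 1 - (((s : ℕ) + 1 : ℕ) : I) ∧ m ≤ (d : ℕ) + lam.parts.get s} := by
  have := (lam.mseg I).finite_sigma_fin
  have := Fintype.ofFinite (Σ q : I × ℕ+, Fin (lam.mseg I q))
  rw [Multisegment.rep,
    QRep.finrank_hom_directSum _ _ fun p => QRep.finite_hom_S _ _ _ p.1.2.pos]
  simp only [QRep.finrank_hom_S _ _ _ (PNat.pos _)]
  exact Multisegment.sum_mseg lam fun i l =>
    Nat.card {d : Fin m // v + ((d : ℕ) : I) = i ∧ m ≤ (d : ℕ) + l}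

lemma dimVec_rep_int (lam : Ptn) (d : ℤ) :
    ((lam.mseg ℤ).rep k).dimVec d = lam.diagCount d := by
  rw [dimVec_rep, diagCount, Finset.card_filter, Finset.sum_range]
  refine Finset.sum_congr rfl fun s _ => ?_
  rw [lam.part_eq_get]
  split_ifs with h
  · rw [Nat.card_eq_one_iff_unique]
    refine ⟨⟨fun t t' => Subtype.ext (Fin.ext ?_)⟩,
      ⟨⟨⟨((s : ℤ) + d).toNat, by omega⟩, by push_cast; omega⟩⟩⟩
    have h₁ := t.2
    have h₂ := t'.2
    push_cast at h₁ h₂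
    omega
  · rw [Nat.card_eq_zero]
    refine Or.inl ⟨fun t => h ?_⟩
    have h₁ := t.2
    push_cast at h₁
    omega

lemma sum_dimVec_rep [Fintype I] (lam : Ptn) :
    ∑ j : I, ((lam.mseg I).rep k).dimVec j = lam.parts.sum := by
  classical
  simp only [dimVec_rep]
  rw [Finset.sum_comm]
  have hs (s : Fin lam.parts.length) : ∑ j : I, Nat.card
      {t : Fin (lam.parts.get s) // 1 - (((s : ℕ) + 1 : ℕ) : I) + ((t : ℕ) : I) = j} =
        lam.parts.get s := by
    rw [← Nat.card_sigma, Nat.card_congr (Equiv.sigmaFiberEquiv _), Nat.card_fin]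
  rw [Finset.sum_congr rfl fun s _ => hs s]
  simp [← List.sum_ofFn]

/-- Summed over all vertices, the homomorphisms to the uniserial representations of length `m`
count the boxes in the first `m` columns. -/
lemma sum_finrank_hom_rep [Fintype I] (lam : Ptn) (m : ℕ) :
    ∑ v : I, Module.finrank k (QRep.Hom ((lam.mseg I).rep k) (QRep.S k v m)) =
      ∑ s : Fin lam.parts.length, min (lam.parts.get s) m := by
  classical
  simp only [finrank_hom_rep]
  rw [Finset.sum_comm]
  refine Finset.sum_congr rfl fun s _ => ?_
  generalize lam.parts.get s = l
  generalize (1 - (((s : ℕ) + 1 : ℕ) : I)) = i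
  -- For every `d` there is exactly one vertex `v` with `v + d = i`.
  have e : (Σ v : I, {d : Fin m // v + ((d : ℕ) : I) = i ∧ m ≤ (d : ℕ) + l}) ≃
      {d : Fin m // m ≤ (d : ℕ) + l} :=
    { toFun := fun p => ⟨p.2.1, p.2.2.2⟩
      invFun := fun d => ⟨i - ((d.1 : ℕ) : I), d.1, by simp, d.2⟩
      left_inv := by
        rintro ⟨v, d, rfl, h⟩
        refine Sigma.ext (by simp) ?_
        congr!; simp
      right_inv := fun _ => rfl }
  have e' : {d : Fin m // m ≤ (d : ℕ) + l} ≃ Fin (min l m) :=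
    { toFun := fun d => ⟨m - 1 - d.1, by omega⟩
      invFun := fun a => ⟨⟨m - 1 - a, by omega⟩, by simp only; omega⟩
      left_inv := fun d => Subtype.ext (Fin.ext (by simp only; omega))
      right_inv := fun a => Fin.ext (by simp only; omega) }
  rw [← Nat.card_sigma, Nat.card_congr (e.trans e'), Nat.card_fin]

lemma eq_of_dimVec_rep_int_eq {lam mu : Ptn}
    (h : ((mu.mseg ℤ).rep k).dimVec = ((lam.mseg ℤ).rep k).dimVec) : mu = lam :=
  eq_of_diagCount_eq fun d => by rw [← dimVec_rep_int (k := k), h, dimVec_rep_int]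

end Ptn

theorem proposition2p1 (k : Type u) [Field k] (lam mu : Ptn) :
    ((((mu.mseg ℤ).rep k).dimVec = ((lam.mseg ℤ).rep k).dimVec ↔ mu = lam) ∧
      ∀ (m : Multisegment ℤ) (nu nu' : Ptn), m = nu.mseg ℤ → m = nu'.mseg ℤ → nu = nu') ∧
    ∀ n : ℕ, 2 ≤ n →
      ((mu.mseg (ZMod n)).rep k).DegLE ((lam.mseg (ZMod n)).rep k) → mu.DomLE lam := by
  refine ⟨⟨⟨Ptn.eq_of_dimVec_rep_int_eq, fun h => by rw [h]⟩, fun m nu nu' h h' =>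
    Ptn.eq_of_dimVec_rep_int_eq (k := k) (by rw [← h, ← h'])⟩, fun n hn h => ?_⟩
  have : NeZero n := ⟨by omega⟩
  refine Ptn.domLE_of_sum_min_le ?_ fun m => ?_
  · rw [← Ptn.sum_dimVec_rep (k := k) (I := ZMod n) mu, h.1, Ptn.sum_dimVec_rep]
  · rw [← Ptn.sum_finrank_hom_rep (k := k) (I := ZMod n) lam m,
      ← Ptn.sum_finrank_hom_rep (k := k) (I := ZMod n) mu m]
    exact Finset.sum_le_sum fun v _ => h.2 _ (QRep.isRepZero_S v m)
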